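/- All rings are commutative with $1$. A difference ring (field) $(A,\sigma)$ is a ring (field) $A$ with a ring automorphism $\sigma$ of $A$; its constants are $\mathrm{const}(A,\sigma)=\{c\in A\mid \sigma(c)=c\}$. An extension of $(A,\sigma)$ is a difference ring containing $A$ as a subring whose automorphism restricts to $\sigma$ on $A$. An extension $(E,\sigma)$ of a difference ring $(A,\sigma)$ is an *APS-extension* if there is a tower of rings $A=A_0\le A_1\le\dots\le A_e=E$, $e\ge 0$, such that for each $1\le i\le e$ one of the following holds: - ($A$-monomial) $A_i=A_{i-1}[t_i]\cong A_{i-1}[X]/(X^{\nu}-1)$, with $t_i$ corresponding to $X$, for some $\nu>1$, and $\sigma(t_i)/t_i\in A_{i-1}^*$ is a primitive $\nu$-th root of unity; - ($P$-monomial) $A_i=A_{i-1}[t_i,t_i^{-1}]$ is a Laurent polynomial ring over $A_{i-1}$ in $t_i$, and $\sigma(t_i)/t_i\in A_{i-1}^*$; - ($S$-monomial) $A_i=A_{i-1}[t_i]$ is a polynomial ring over $A_{i-1}$ in $t_i$, and $\sigma(t_i)-t_i\in A_{i-1}$. It is *basic* if for every $P$-monomial $t_i$ the quotient $\sigma(t_i)/t_i$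 has the form $h\,t_1^{m_1}\cdots t_{i-1}^{m_{i-1}}$ with $h\in A^*$ and $m_j\in\mathbb Z$, where $m_j=0$ unless $t_j$ is a $P$-monomial, and for every $A$-monomial $t_i$ the element $\alpha_i=\sigma(t_i)/t_i$ lies in $A^*$ and satisfies $\sigma(\alpha_i)=\alpha_i$. For a field $K$ let $S(K)$ be the ring of sequences $(a_n)_{n\ge0}$ in $K$ with componentwise operations, where two sequences are identified if they agree from some point on. The shift $S\colon(a_0,a_1,a_2,\dots)\mapsto(a_1,a_2,a_3,\dots)$ is a ring automorphism of $S(K)$. **Theorem.** Let $(E,\sigma)$ be a basic APS-extension of a difference field $(F,\sigma)$ with constant field $K=\mathrm{const}(F,\sigma)$, and let $\tau\colon E\to S(K)$ be a $K$-homomorphism, i.e., a ring homomorphism with $\tau(\sigma(f))=S(\tau(f))$ for all $f\in E$ and $\tau(c)=(c,c,c,\dots)$ for all $c\in K$. Then $\tau$ is injective if and only if $\mathrm{const}(E,\sigma)=K$. -/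

import Mathlib

open Filter Polynomial

noncomputable section

/-! Difference rings are pairs of a commutative ring `R` and a ring automorphism `σ : R ≃+* R`. -/

/-- `(E, σE)` is a difference ring extension of `(R, σR)`: the structure map `R → E` is an
embedding along which `σE` restricts to `σR`. -/
structure IsDifferenceExtension {R E : Type*} [CommRing R] [CommRing E] [Algebra R E]
    (σR : R ≃+* R) (σE : E ≃+* E) : Prop where
  injective : Function.Injective (algebraMap R E)
  commutes : ∀ r : R, σE (algebraMap R E r) = algebraMap R E (σR r)

/-- The ring of constants `const(R, σ) = {c ∈ R | σ c = c}` of a difference ring. -/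
def constRing {R : Type*} [CommRing R] (σ : R ≃+* R) : Subring R where
  carrier := {c | σ c = c}
  mul_mem' {a b} ha hb := by simp_all
  one_mem' := by simp
  add_mem' {a b} ha hb := by simp_all
  zero_mem' := by simp
  neg_mem' {a} ha := by simp_all

/-- The constant field of a difference field. -/
def constField {F : Type*} [Field F] (σ : F ≃+* F) : Subfield F where
  toSubring := constRing σ
  inv_mem' a ha := by
    change σ a⁻¹ = a⁻¹
    rw [map_inv₀, show σ a = a from ha]

/-! ### APS-extensions -/

/-- The three kinds of adjoined monomials: an A-monomial `t` of order `ν`, a P-monomial `t`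
(invertible), an S-monomial `t`. -/
inductive APSMonomial (E : Type*) [CommRing E] where
  | A (ν : ℕ) (t : E)
  | P (t : Eˣ)
  | S (t : E)

/-- The `P`-part of a monomial: `t` for a P-monomial `t`, and `1` for an A- or S-monomial. -/
def APSMonomial.pPart {E : Type*} [CommRing E] : APSMonomial E → Eˣ
  | .A _ _ => 1
  | .P t => t
  | .S _ => 1

/-- `IsAPSStep σ B C m`: for subrings `B` and `C` of the difference ring `(E, σ)`, the ring `C` is
`B⟨t⟩`, obtained by adjoining the APS-monomial `m = t` to `B`. That is:
* A-monomial of order `ν > 1`: `C = B[t] ≅ B[X] / (X ^ ν - 1)` through `X ↦ t`, and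
  `σ t / t ∈ Bˣ` is a primitive `ν`-th root of unity;
* P-monomial: `C = B[t, t⁻¹]` is a Laurent polynomial ring over `B` in `t`, and `σ t / t ∈ Bˣ`;
* S-monomial: `C = B[t]` is a polynomial ring over `B` in `t`, and `σ t - t ∈ B`. -/
def IsAPSStep {E : Type*} [CommRing E] (σ : E ≃+* E) (B C : Subring E) : APSMonomial E → Prop
  | .A ν t =>
      1 < ν ∧
      (eval₂RingHom B.subtype t).range = C ∧
      RingHom.ker (eval₂RingHom B.subtype t) = Ideal.span {(X : B[X]) ^ ν - 1} ∧
      ∃ α : Bˣ, IsPrimitiveRoot α ν ∧ σ t = (α : B) * t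
  | .P t =>
      (LaurentPolynomial.eval₂ B.subtype t).range = C ∧
      Function.Injective (LaurentPolynomial.eval₂ B.subtype t) ∧
      ∃ α : Bˣ, σ t = (α : B) * t
  | .S t =>
      (eval₂RingHom B.subtype t).range = C ∧
      Function.Injective (eval₂RingHom B.subtype t) ∧
      σ t - t ∈ B

/-- An APS-extension `(E, σE)` of a difference ring `(R, σR)`, together with its tower
`R = A₀ ≤ A₁ ≤ ⋯ ≤ Aₑ = E` where `Aᵢ₊₁ = Aᵢ⟨tᵢ⟩`. -/
structure APSExtension {R E : Type*} [CommRing R] [CommRing E] [Algebra R E]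
    (σR : R ≃+* R) (σE : E ≃+* E) where
  isDifferenceExtension : IsDifferenceExtension σR σE
  e : ℕ
  ring : Fin (e + 1) → Subring E
  mon : Fin e → APSMonomial E
  ring_zero : ring 0 = (algebraMap R E).range
  ring_last : ring (Fin.last e) = ⊤
  step : ∀ i : Fin e, IsAPSStep σE (ring i.castSucc) (ring i.succ) (mon i)

namespace APSExtension

variable {R E : Type*} [CommRing R] [CommRing E] [Algebra R E] {σR : R ≃+* R} {σE : E ≃+* E}

/-- The basic product group `[G]` over `G ≤ Rˣ` for the extension `Aᵢ = R⟨t₀⟩…⟨tᵢ₋₁⟩` of `R`: all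
elements `h * ∏ j < i, tⱼ ^ mⱼ` with `h ∈ G` and `mⱼ ∈ ℤ`, where only P-monomials `tⱼ` occur. -/
def basicProductGroup (T : APSExtension σR σE) (G : Subgroup Rˣ) (i : Fin T.e) : Set Eˣ :=
  {u | ∃ h ∈ G, ∃ m : Fin T.e → ℤ,
    u = Units.map (algebraMap R E : R →* E) h * ∏ j ∈ Finset.Iio i, (T.mon j).pPart ^ m j}

/-- The condition on the `i`-th monomial `t` in a `G`-basic extension: `σ t / t` is in the basic
product group of the previous ring if `t` is a P-monomial, and it is an element of `G` fixed by `σ`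
if `t` is an A-monomial; there is no condition on an S-monomial. -/
def IsBasicAt (T : APSExtension σR σE) (G : Subgroup Rˣ) (i : Fin T.e) : APSMonomial E → Prop
  | .A _ t => ∃ α ∈ G, σE t = algebraMap R E (α : R) * t ∧ σR (α : R) = α
  | .P t => ∃ u ∈ T.basicProductGroup G i, σE t = u * t
  | .S _ => True

/-- `G`-basic APS-extensions. -/
def IsGBasic (T : APSExtension σR σE) (G : Subgroup Rˣ) : Prop :=
  ∀ i, T.IsBasicAt G i (T.mon i)

/-- Basic APS-extensions: `G`-basic with `G = Rˣ`. -/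
def IsBasic (T : APSExtension σR σE) : Prop := T.IsGBasic ⊤

end APSExtension

/-! ### The ring of sequences -/

/-- The ring `S(K)` of sequences over `K`, where two sequences are identified if they agree from a
certain point on; the operations are componentwise. -/
abbrev SeqRing (K : Type*) : Type _ := Germ (atTop : Filter ℕ) K

/-- The shift automorphism `(a₀, a₁, a₂, …) ↦ (a₁, a₂, a₃, …)` of `S(K)`. -/
def SeqRing.shift (K : Type*) [CommRing K] : SeqRing K ≃+* SeqRing K where
  toFun f := f.compTendsto (fun n => n + 1) (tendsto_add_atTop_nat 1)
  invFun f := f.compTendsto (fun n => n - 1) (tendsto_sub_atTop_nat 1)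
  left_inv f := by
    induction f using Germ.inductionOn with
    | h f =>
      refine Germ.coe_eq.2 ?_
      filter_upwards [eventually_ge_atTop 1] with n hn
      simp [Nat.sub_add_cancel hn]
  right_inv f := by
    induction f using Germ.inductionOn with
    | h f => exact Germ.coe_eq.2 (Eventually.of_forall fun n => by simp)
  map_mul' f g := by
    induction f, g using Germ.inductionOn₂ with
    | h f g => rfl
  map_add' f g := by
    induction f, g using Germ.inductionOn₂ with
    | h f g => rfl

/-- Let `(E, σE)` be a difference ring over `(F, σF)`, and let `K = const(F, σF)`. A ring
homomorphism `τ : E → S(K)` is a `K`-homomorphism if `τ (σ f) = S (τ f)` for all `f ∈ E` and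
`τ c = (c, c, c, …)` for all `c ∈ K`. -/
structure IsKHomomorphism {F E : Type*} [Field F] [CommRing E] [Algebra F E]
    (σF : F ≃+* F) (σE : E ≃+* E) (τ : E →+* SeqRing (constField σF)) : Prop where
  map_shift : ∀ f : E, τ (σE f) = SeqRing.shift (constField σF) (τ f)
  map_const : ∀ c : constField σF,
    τ (algebraMap F E (c : F)) = ((fun _ : ℕ => c : ℕ → constField σF) : SeqRing (constField σF))

end

/-! If `τ` is injective, a constant of `E` maps to a shift-invariant germ; such a germ is a constant
sequence, hence already the image of an element of `K`. Conversely, the kernel of `τ` is an ideal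
stable under `σ` and its inverse, and it omits `1`. So it suffices that `E` is difference simple
when no constants are added (`APSExtension.isDifferenceSimple_top`). This climbs the tower. In a
nonzero stable ideal of `B⟨t⟩`, the leading coefficients in the least possible degree `n` form a
nonzero stable ideal of `B`, so the ideal contains a monic `f` of degree `n`. Since `σ t = α t + β`,
the difference `σ f - α ^ n f` has lower degree and vanishes (`exists_semiinvariant`). Then `f`
(S-monomial, `α = 1`) or `f / t ^ n` (A- or P-monomial, `β = 0`) is a nonzero constant, hence a
unit. Degree is measured by spans of powers of `t`, so the dependent powers of an A-monomial need no
separate treatment. -/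

section

/-! ### Degree filtration and affine automorphisms -/

variable {E : Type*} [CommRing E]

/-- The elements `∑ i < n, bᵢ tⁱ` with coefficients `bᵢ` in the subring `B`. -/
def degLT (B : Subring E) (t : E) (n : ℕ) : Submodule B E :=
  Submodule.span B ((fun i : ℕ => t ^ i) '' Set.Iio n)

theorem mem_degLT_zero {B : Subring E} {t x : E} : x ∈ degLT B t 0 ↔ x = 0 := by
  simp [degLT]

theorem mem_degLT_succ {B : Subring E} {t x : E} {n : ℕ} :
    x ∈ degLT B t (n + 1) ↔ ∃ b ∈ B, ∃ v ∈ degLT B t n, x = b * t ^ n + v := by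
  have h : Set.Iio (n + 1) = insert n (Set.Iio n) := by
    ext i
    simp only [Set.mem_Iio, Set.mem_insert_iff]
    omega
  rw [degLT, h, Set.image_insert_eq, Submodule.mem_span_insert]
  constructor
  · rintro ⟨b, v, hv, rfl⟩
    exact ⟨b, b.2, v, hv, rfl⟩
  · rintro ⟨b, hb, v, hv, rfl⟩
    exact ⟨⟨b, hb⟩, v, hv, rfl⟩

theorem mul_mem_degLT {B : Subring E} {t b x : E} {n : ℕ} (hb : b ∈ B) (hx : x ∈ degLT B t n) :
    b * x ∈ degLT B t n :=
  (degLT B t n).smul_mem (⟨b, hb⟩ : B) hx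

theorem degLT_mono {B : Subring E} {t : E} {m n : ℕ} (h : m ≤ n) : degLT B t m ≤ degLT B t n :=
  Submodule.span_mono (Set.image_mono (Set.Iio_subset_Iio h))

theorem gen_mul_mem_degLT {B : Subring E} {t x : E} {n : ℕ} (hx : x ∈ degLT B t n) :
    t * x ∈ degLT B t (n + 1) := by
  induction n generalizing x with
  | zero => simp [mem_degLT_zero.1 hx]
  | succ n ih =>
    obtain ⟨b, hb, v, hv, rfl⟩ := mem_degLT_succ.1 hx
    exact mem_degLT_succ.2 ⟨b, hb, t * v, ih hv, by ring⟩

theorem eval₂_mem_degLT {B : Subring E} {t : E} (p : B[X]) :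
    p.eval₂ B.subtype t ∈ degLT B t (p.natDegree + 1) := by
  rw [eval₂_eq_sum_range]
  refine Submodule.sum_mem _ fun i hi => mul_mem_degLT (p.coeff i).2 ?_
  exact Submodule.subset_span ⟨i, Finset.mem_range.1 hi, rfl⟩

theorem affine_pow_sub_mem_degLT {B : Subring E} {t α β : E} (hα : α ∈ B) (hβ : β ∈ B) (n : ℕ) :
    (α * t + β) ^ n - α ^ n * t ^ n ∈ degLT B t n := by
  induction n with
  | zero => simp
  | succ n ih =>
    have h1 := mul_mem_degLT hα (gen_mul_mem_degLT ih)
    have h2 := mul_mem_degLT hβ (degLT_mono n.le_succ ih)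
    have h3 : β * α ^ n * t ^ n ∈ degLT B t (n + 1) :=
      mem_degLT_succ.2 ⟨_, mul_mem hβ (pow_mem hα n), 0, zero_mem _, by ring⟩
    convert add_mem (add_mem h1 h2) h3 using 1
    ring

theorem map_mem_degLT {B : Subring E} {t α β : E} {σ : E ≃+* E} (hσ : ∀ b ∈ B, σ b ∈ B)
    (hα : α ∈ B) (hβ : β ∈ B) (ht : σ t = α * t + β) {n : ℕ} {x : E} (hx : x ∈ degLT B t n) :
    σ x ∈ degLT B t n := by
  induction n generalizing x with
  | zero => simp [mem_degLT_zero.1 hx]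
  | succ n ih =>
    obtain ⟨b, hb, v, hv, rfl⟩ := mem_degLT_succ.1 hx
    refine mem_degLT_succ.2 ⟨σ b * α ^ n, mul_mem (hσ b hb) (pow_mem hα n), _,
      add_mem (mul_mem_degLT (hσ b hb) (affine_pow_sub_mem_degLT hα hβ n)) (ih hv), ?_⟩
    rw [map_add, map_mul, map_pow, ht]
    ring

/-- The subring `B` of the difference ring `(E, σ)` is stable under `σ` and `σ⁻¹`. -/
def IsStable (σ : E ≃+* E) (B : Subring E) : Prop := ∀ x, σ x ∈ B ↔ x ∈ B

/-- Every nonzero ideal of the subring `B` that is stable under `σ` and `σ⁻¹` contains `1`. -/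
def IsDifferenceSimple (σ : E ≃+* E) (B : Subring E) : Prop :=
  ∀ I : AddSubgroup E, (∀ x ∈ I, x ∈ B) → (∀ b ∈ B, ∀ x ∈ I, b * x ∈ I) →
    (∀ x, σ x ∈ I ↔ x ∈ I) → (∃ x ∈ I, x ≠ 0) → 1 ∈ I

theorem IsStable.symm_mem {σ : E ≃+* E} {B : Subring E} (h : IsStable σ B) {x : E} (hx : x ∈ B) :
    σ.symm x ∈ B :=
  (h _).1 (by simpa using hx)

/-- The inverse automorphism is again affine in `t`, so statements proved for `σ` also apply to
`σ.symm`. -/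
theorem symm_affine {σ : E ≃+* E} {t α α' β : E} (hα : α' * α = 1) (ht : σ t = α * t + β) :
    σ.symm t = σ.symm α' * t + -(σ.symm α' * σ.symm β) := by
  apply σ.injective
  simp only [RingEquiv.apply_symm_apply, map_add, map_mul, map_neg, ht]
  linear_combination (-t) * hα

/-- The `n`-th leading coefficients of the elements of `I` in `degLT B t (n + 1)`. -/
def leadingCoeffs (B : Subring E) (t : E) (I : AddSubgroup E) (n : ℕ) : AddSubgroup E where
  carrier := {b | b ∈ B ∧ ∃ v ∈ degLT B t n, b * t ^ n + v ∈ I}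
  zero_mem' := ⟨zero_mem B, 0, zero_mem _, by simp⟩
  add_mem' := by
    rintro a b ⟨ha, v, hv, hav⟩ ⟨hb, w, hw, hbw⟩
    refine ⟨add_mem ha hb, v + w, add_mem hv hw, ?_⟩
    convert add_mem hav hbw using 1
    ring
  neg_mem' := by
    rintro a ⟨ha, v, hv, hav⟩
    refine ⟨neg_mem ha, -v, neg_mem hv, ?_⟩
    convert neg_mem hav using 1
    ring

/-- Applying `σ` turns the leading coefficient `b` into `σ b * α ^ n`; multiplying by `α' ^ n`
removes the extra factor. -/
theorem map_mem_leadingCoeffs {B : Subring E} {t α α' β : E} {σ : E ≃+* E}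
    (hσ : ∀ b ∈ B, σ b ∈ B) (hα : α ∈ B) (hα' : α' ∈ B) (hαα' : α' * α = 1) (hβ : β ∈ B)
    (ht : σ t = α * t + β) {I : AddSubgroup E} (hI : ∀ b ∈ B, ∀ x ∈ I, b * x ∈ I)
    (hIσ : ∀ x ∈ I, σ x ∈ I) {n : ℕ} {b : E} (hb : b ∈ leadingCoeffs B t I n) :
    σ b ∈ leadingCoeffs B t I n := by
  obtain ⟨hb, v, hv, hbv⟩ := hb
  refine ⟨hσ b hb, _, mul_mem_degLT (pow_mem hα' n)
    (add_mem (mul_mem_degLT (hσ b hb) (affine_pow_sub_mem_degLT hα hβ n))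
      (map_mem_degLT hσ hα hβ ht hv)), ?_⟩
  convert hI _ (pow_mem hα' n) _ (hIσ _ hbv) using 1
  have h : α' ^ n * α ^ n = 1 := by rw [← mul_pow, hαα', one_pow]
  rw [map_add, map_mul, map_pow, ht]
  linear_combination (-(σ b * t ^ n)) * h

/-- A nonzero stable ideal of `B⟨t⟩`, with `B` difference simple, contains a nonzero element `f`
with `σ f = α ^ n * f`. -/
theorem exists_semiinvariant {B : Subring E} {t α α' β : E} {σ : E ≃+* E}
    (hσ : IsStable σ B) (hB : IsDifferenceSimple σ B) (hα : α ∈ B) (hα' : α' ∈ B)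
    (hαα' : α' * α = 1) (hβ : β ∈ B) (ht : σ t = α * t + β) {I : AddSubgroup E}
    (hI : ∀ b ∈ B, ∀ x ∈ I, b * x ∈ I) (hIσ : ∀ x, σ x ∈ I ↔ x ∈ I)
    (hne : ∃ n, ∃ x ∈ degLT B t n, x ∈ I ∧ x ≠ 0) :
    ∃ n : ℕ, ∃ f ∈ I, f ≠ 0 ∧ σ f = α ^ n * f := by
  classical
  obtain ⟨x, hx, hxI, hx0⟩ := Nat.find_spec hne
  have hmin : ∀ m < Nat.find hne, ∀ y ∈ degLT B t m, y ∈ I → y = 0 := by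
    intro m hm y hy hyI
    by_contra hy0
    exact Nat.find_min hne hm ⟨y, hy, hyI, hy0⟩
  generalize Nat.find hne = N at hx hmin
  obtain _ | n := N
  · exact absurd (mem_degLT_zero.1 hx) hx0
  obtain ⟨b, hb, v, hv, rfl⟩ := mem_degLT_succ.1 hx
  have hσ' : ∀ b ∈ B, σ.symm b ∈ B := fun b hb => hσ.symm_mem hb
  -- Difference simplicity of `B` makes a leading coefficient equal to `1`; stability under `σ⁻¹`
  -- uses the affine form of `σ.symm t`.
  have hone : (1 : E) ∈ leadingCoeffs B t I n := by
    apply hB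
    · exact fun x hx => hx.1
    · rintro c hc a ⟨ha, w, hw, haw⟩
      refine ⟨mul_mem hc ha, c * w, mul_mem_degLT hc hw, ?_⟩
      convert hI c hc _ haw using 1
      ring
    · refine fun a => ⟨fun h => ?_, map_mem_leadingCoeffs (fun b hb => (hσ b).2 hb) hα hα' hαα' hβ
        ht hI fun x => (hIσ x).2⟩
      have := map_mem_leadingCoeffs (α' := σ.symm α) hσ' (hσ' _ hα') (hσ' _ hα)
        (by rw [← map_mul, mul_comm, hαα', map_one])
        (neg_mem (mul_mem (hσ' _ hα') (hσ' _ hβ))) (symm_affine hαα' ht) hI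
        (fun x hx => (hIσ _).1 (by simpa using hx)) h
      simpa using this
    · refine ⟨b, ⟨hb, v, hv, hxI⟩, ?_⟩
      rintro rfl
      exact hx0 (hmin n n.lt_succ_self _ (by simpa using hv) hxI)
  obtain ⟨-, w, hw, hfI⟩ := hone
  refine ⟨n, _, hfI, fun hf => ?_, ?_⟩
  -- Powers of `t` may be dependent, so a monic element could vanish; but then `t ^ n = -w` would
  -- put the minimal element in lower degree.
  · refine hx0 (hmin n n.lt_succ_self _ ?_ hxI)
    have : b * t ^ n + v = v - b * w := by linear_combination b * hf
    rw [this]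
    exact sub_mem hv (mul_mem_degLT hb hw)
  -- The terms `α ^ n * t ^ n` cancel in `σ f - α ^ n * f`, so minimality forces it to be zero.
  · refine sub_eq_zero.1 (hmin n n.lt_succ_self _ ?_
      (sub_mem ((hIσ _).2 hfI) (hI _ (pow_mem hα n) _ hfI)))
    have := sub_mem (add_mem (affine_pow_sub_mem_degLT (t := t) hα hβ n)
      (map_mem_degLT (fun b hb => (hσ b).2 hb) hα hβ ht hw)) (mul_mem_degLT (pow_mem hα n) hw)
    convert this using 1
    rw [map_add, map_mul, map_pow, ht, map_one]
    ring

/-! ### Difference simplicity and stability for one step -/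

/-- An extension by a monomial `t` with `σ t - t ∈ B` preserves difference simplicity if no new
constants arise. -/
theorem IsDifferenceSimple.adjoin_sum {B C : Subring E} {t : E} {σ : E ≃+* E}
    (hσ : IsStable σ B) (hB : IsDifferenceSimple σ B)
    (hC : (eval₂RingHom B.subtype t).range = C) (ht : σ t - t ∈ B)
    (hconst : ∀ x, σ x = x → x ≠ 0 → ∃ y ∈ B, y * x = 1) : IsDifferenceSimple σ C := by
  subst hC
  intro I hIC hI hIσ ⟨x, hxI, hx0⟩
  have hBC : ∀ b ∈ B, b ∈ (eval₂RingHom B.subtype t).range := fun b hb => ⟨.C ⟨b, hb⟩, by simp⟩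
  obtain ⟨p, hp⟩ := hIC x hxI
  obtain ⟨n, f, hfI, hf0, hf⟩ := exists_semiinvariant (α := 1) (α' := 1) (β := σ t - t) hσ hB
    (one_mem B) (one_mem B) (one_mul 1) ht (by ring) (fun b hb => hI b (hBC b hb)) hIσ
    ⟨p.natDegree + 1, x, by rw [← hp]; exact eval₂_mem_degLT p, hxI, hx0⟩
  obtain ⟨y, hy, hyf⟩ := hconst f (by simpa using hf) hf0
  exact hyf ▸ hI y (hBC y hy) f hfI

/-- An extension by an invertible monomial `t` with `σ t / t ∈ Bˣ` preserves difference
simplicity if no new constants arise. -/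
theorem IsDifferenceSimple.adjoin_unit {B C : Subring E} {t s : E} {σ : E ≃+* E}
    (hσ : IsStable σ B) (hB : IsDifferenceSimple σ B) (hBC : B ≤ C) (hs : s ∈ C)
    (hts : t * s = 1)
    (hC : ∀ x ∈ C, ∃ k : ℕ, ∃ p : B[X], t ^ k * x = p.eval₂ B.subtype t) (htC : t ∈ C)
    (α : Bˣ) (ht : σ t = (α : B) * t)
    (hconst : ∀ x, σ x = x → x ≠ 0 → ∃ y ∈ B, y * x = 1) : IsDifferenceSimple σ C := by
  intro I hIC hI hIσ ⟨x, hxI, hx0⟩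
  obtain ⟨k, p, hp⟩ := hC x (hIC x hxI)
  have hcancel : ∀ m : ℕ, s ^ m * t ^ m = 1 := fun m => by
    rw [← mul_pow, mul_comm, hts, one_pow]
  have hαα' : ((α⁻¹ : Bˣ) : B) * ((α : B) : E) = 1 := by
    rw [← Subring.coe_mul, Units.inv_mul, Subring.coe_one]
  obtain ⟨n, f, hfI, hf0, hf⟩ := exists_semiinvariant (β := 0) hσ hB
    (α : B).2 ((α⁻¹ : Bˣ) : B).2 hαα' (zero_mem B) (by rw [ht, add_zero])
    (fun b hb => hI b (hBC hb)) hIσ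
    ⟨_, t ^ k * x, hp ▸ eval₂_mem_degLT p, hI _ (pow_mem htC k) _ hxI, fun h => hx0 <| by
      linear_combination s ^ k * h - x * hcancel k⟩
  have hσs : ((α : B) : E) * σ s = s := by
    have := congrArg σ hts
    rw [map_mul, ht, map_one] at this
    linear_combination s * this - (α : B) * σ s * hts
  -- Here `s = t⁻¹` and `σ s = α⁻¹ * s`, so `s ^ n` compensates the factor `α ^ n` of `f`.
  obtain ⟨y, hy, hyf⟩ := hconst (s ^ n * f)
    (by
      rw [map_mul, map_pow, hf, ← mul_assoc, ← mul_pow, mul_comm (σ s), hσs])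
    (fun h => hf0 (by linear_combination t ^ n * h - f * hcancel n))
  rw [← hyf]
  exact hI y (hBC hy) _ (hI _ (pow_mem hs n) f hfI)

theorem LaurentPolynomial.eval₂_range_le {B D : Subring E} {t : Eˣ} (hB : B ≤ D)
    (ht : (t : E) ∈ D) (ht' : ((t⁻¹ : Eˣ) : E) ∈ D) :
    (LaurentPolynomial.eval₂ B.subtype t).range ≤ D := by
  rintro _ ⟨p, rfl⟩
  obtain ⟨n, q, hq⟩ := LaurentPolynomial.exists_T_pow p
  have h := congrArg (LaurentPolynomial.eval₂ B.subtype t) hq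
  rw [map_mul, LaurentPolynomial.eval₂_toLaurent, LaurentPolynomial.eval₂_T_n] at h
  have : LaurentPolynomial.eval₂ B.subtype t p =
      q.eval₂ B.subtype t * ((t⁻¹ : Eˣ) : E) ^ n := by
    rw [h, mul_assoc, ← mul_pow]
    simp
  rw [this, eval₂_eq_sum_range]
  exact mul_mem (sum_mem fun i _ => mul_mem (hB (q.coeff i).2) (pow_mem ht i)) (pow_mem ht' n)

theorem Polynomial.eval₂RingHom_range_le {B D : Subring E} {t : E} (hB : B ≤ D) (ht : t ∈ D) :
    (eval₂RingHom B.subtype t).range ≤ D := by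
  rintro _ ⟨p, rfl⟩
  rw [coe_eval₂RingHom, eval₂_eq_sum_range]
  exact sum_mem fun i _ => mul_mem (hB (p.coeff i).2) (pow_mem ht i)

theorem isStable_of_le {σ : E ≃+* E} {C : Subring E} (h : C ≤ C.comap (σ : E →+* E))
    (h' : C ≤ C.comap (σ.symm : E →+* E)) : IsStable σ C :=
  fun x => ⟨fun hx => by simpa using h' hx, fun hx => h hx⟩

theorem le_range_eval₂RingHom (B : Subring E) (t : E) : B ≤ (eval₂RingHom B.subtype t).range :=
  fun b hb => ⟨.C ⟨b, hb⟩, by simp⟩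

theorem mem_range_eval₂RingHom (B : Subring E) (t : E) : t ∈ (eval₂RingHom B.subtype t).range :=
  ⟨X, by simp⟩

theorem isStable_eval₂RingHom_range {B : Subring E} {t α α' β : E} {σ : E ≃+* E}
    (hσ : IsStable σ B) (hα : α ∈ B) (hα' : α' ∈ B) (hαα' : α' * α = 1) (hβ : β ∈ B)
    (ht : σ t = α * t + β) : IsStable σ (eval₂RingHom B.subtype t).range := by
  have hBC := le_range_eval₂RingHom B t
  have htC := mem_range_eval₂RingHom B t
  refine isStable_of_le (eval₂RingHom_range_le (fun b hb => hBC ((hσ b).2 hb)) ?_)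
    (eval₂RingHom_range_le (fun b hb => hBC (hσ.symm_mem hb)) ?_)
  · change σ t ∈ (eval₂RingHom B.subtype t).range
    exact ht ▸ add_mem (mul_mem (hBC hα) htC) (hBC hβ)
  · change σ.symm t ∈ (eval₂RingHom B.subtype t).range
    rw [symm_affine hαα' ht]
    exact add_mem (mul_mem (hBC (hσ.symm_mem hα')) htC)
      (hBC (neg_mem (mul_mem (hσ.symm_mem hα') (hσ.symm_mem hβ))))

theorem isStable_laurent_range {B : Subring E} {t : Eˣ} {σ : E ≃+* E}
    (hσ : IsStable σ B) (α : Bˣ) (ht : σ t = (α : B) * t) :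
    IsStable σ (LaurentPolynomial.eval₂ B.subtype t).range := by
  set C := (LaurentPolynomial.eval₂ B.subtype t).range with hC
  have hBC : ∀ b ∈ B, b ∈ C := fun b hb => ⟨LaurentPolynomial.C ⟨b, hb⟩, by simp⟩
  have htC : (t : E) ∈ C := ⟨LaurentPolynomial.T 1, by simp⟩
  have htC' : ((t⁻¹ : Eˣ) : E) ∈ C := ⟨LaurentPolynomial.T (-1), by simp⟩
  have hαα' : ((α⁻¹ : Bˣ) : B) * ((α : B) : E) = 1 := by
    rw [← Subring.coe_mul, Units.inv_mul, Subring.coe_one]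
  have hinv : (t : E) * ((t⁻¹ : Eˣ) : E) = 1 := t.mul_inv
  have hσt : σ ((t⁻¹ : Eˣ) : E) = ((α⁻¹ : Bˣ) : B) * ((t⁻¹ : Eˣ) : E) := by
    have := congrArg σ hinv
    rw [map_mul, map_one, ht] at this
    linear_combination ((α⁻¹ : Bˣ) : B) * ((t⁻¹ : Eˣ) : E) * this
      - σ ((t⁻¹ : Eˣ) : E) * hinv * ((α⁻¹ : Bˣ) : B) * ((α : B) : E) - σ ((t⁻¹ : Eˣ) : E) * hαα'
  refine isStable_of_le (LaurentPolynomial.eval₂_range_le (fun b hb => hBC _ ((hσ b).2 hb)) ?_ ?_)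
    (LaurentPolynomial.eval₂_range_le (fun b hb => hBC _ (hσ.symm_mem hb)) ?_ ?_)
  · change σ t ∈ C
    exact ht ▸ mul_mem (hBC _ (α : B).2) htC
  · change σ ((t⁻¹ : Eˣ) : E) ∈ C
    exact hσt ▸ mul_mem (hBC _ ((α⁻¹ : Bˣ) : B).2) htC'
  · change σ.symm t ∈ C
    have : σ.symm t = σ.symm (((α⁻¹ : Bˣ) : B) : E) * t := by
      apply σ.injective
      rw [map_mul, σ.apply_symm_apply, σ.apply_symm_apply, ht, ← mul_assoc, hαα', one_mul]
    exact this ▸ mul_mem (hBC _ (hσ.symm_mem ((α⁻¹ : Bˣ) : B).2)) htC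
  · change σ.symm ((t⁻¹ : Eˣ) : E) ∈ C
    have : σ.symm ((t⁻¹ : Eˣ) : E) = σ.symm ((α : B) : E) * ((t⁻¹ : Eˣ) : E) := by
      apply σ.injective
      rw [map_mul, σ.apply_symm_apply, σ.apply_symm_apply, hσt, ← mul_assoc, mul_comm _ (_ : E),
        mul_comm (((α : B) : E)), hαα', mul_one]
    exact this ▸ mul_mem (hBC _ (hσ.symm_mem (α : B).2)) htC'

/-- An APS-step that adds no constants preserves stability and difference simplicity. -/
theorem IsAPSStep.isStable_and_isDifferenceSimple {σ : E ≃+* E} {B C : Subring E}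
    {m : APSMonomial E} (h : IsAPSStep σ B C m) (hσ : IsStable σ B)
    (hB : IsDifferenceSimple σ B) (hconst : ∀ x, σ x = x → x ≠ 0 → ∃ y ∈ B, y * x = 1) :
    B ≤ C ∧ IsStable σ C ∧ IsDifferenceSimple σ C := by
  cases m with
  | A ν t =>
    obtain ⟨hν, rfl, hker, α, -, ht⟩ := h
    have htν : t ^ ν = 1 := by
      have : (X : B[X]) ^ ν - 1 ∈ RingHom.ker (eval₂RingHom B.subtype t) :=
        hker ▸ Ideal.mem_span_singleton_self _
      simpa [RingHom.mem_ker, sub_eq_zero] using this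
    have htC := mem_range_eval₂RingHom B t
    -- As `t ^ ν = 1`, the inverse of `t` is `t ^ (ν - 1)`, and no denominators need clearing.
    refine ⟨le_range_eval₂RingHom B t, isStable_eval₂RingHom_range (β := 0) hσ
      (α : B).2 ((α⁻¹ : Bˣ) : B).2 ?_ (zero_mem B) (by rw [ht, add_zero]),
      hB.adjoin_unit hσ (le_range_eval₂RingHom B t) (pow_mem htC (ν - 1)) ?_ ?_ htC α ht hconst⟩
    · rw [← Subring.coe_mul, Units.inv_mul, Subring.coe_one]
    · rw [← pow_succ', Nat.sub_add_cancel hν.le, htν]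
    · rintro _ ⟨p, rfl⟩
      exact ⟨0, p, by simp⟩
  | P t =>
    obtain ⟨rfl, -, α, ht⟩ := h
    have hBC : B ≤ (LaurentPolynomial.eval₂ B.subtype t).range :=
      fun b hb => ⟨LaurentPolynomial.C ⟨b, hb⟩, by simp⟩
    refine ⟨hBC, isStable_laurent_range hσ α ht, hB.adjoin_unit hσ hBC
      (s := ((t⁻¹ : Eˣ) : E)) ⟨LaurentPolynomial.T (-1), by simp⟩ t.mul_inv ?_
      ⟨LaurentPolynomial.T 1, by simp⟩ α ht hconst⟩
    rintro _ ⟨p, rfl⟩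
    obtain ⟨n, q, hq⟩ := LaurentPolynomial.exists_T_pow p
    refine ⟨n, q, ?_⟩
    rw [← LaurentPolynomial.eval₂_toLaurent, hq, map_mul, LaurentPolynomial.eval₂_T_n, mul_comm]
  | S t =>
    obtain ⟨rfl, -, ht⟩ := h
    exact ⟨le_range_eval₂RingHom B t, isStable_eval₂RingHom_range (α := 1) (α' := 1) hσ (one_mem B)
      (one_mem B) (one_mul 1) ht (by ring), hB.adjoin_sum hσ rfl ht hconst⟩

end

/-! ### The whole tower, and the sequence ring -/

/-- An APS-extension of a difference field without new constants is difference simple. -/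
theorem APSExtension.isDifferenceSimple_top {F E : Type*} [Field F] [CommRing E] [Algebra F E]
    {σF : F ≃+* F} {σE : E ≃+* E} (T : APSExtension σF σE)
    (hc : constRing σE = (constField σF).toSubring.map (algebraMap F E)) :
    IsDifferenceSimple σE ⊤ := by
  -- The inclusion of `F` is carried along so that inverses of nonzero constants are available at
  -- every level.
  have key : ∀ i, (algebraMap F E).range ≤ T.ring i ∧ IsStable σE (T.ring i) ∧
      IsDifferenceSimple σE (T.ring i) := by
    intro i
    induction i using Fin.induction with
    | zero =>
      rw [T.ring_zero]
      have hcomm := T.isDifferenceExtension.commutes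
      refine ⟨le_rfl, fun x => ⟨?_, ?_⟩, ?_⟩
      · rintro ⟨y, hy⟩
        refine ⟨σF.symm y, σE.injective ?_⟩
        rw [hcomm, σF.apply_symm_apply, hy]
      · rintro ⟨y, rfl⟩
        exact ⟨σF y, (hcomm y).symm⟩
      · rintro I hIF hI - ⟨x, hxI, hx0⟩
        obtain ⟨y, rfl⟩ := hIF x hxI
        have hy : y ≠ 0 := by
          rintro rfl
          exact hx0 (map_zero _)
        have := hI _ ⟨y⁻¹, rfl⟩ _ hxI
        rwa [← map_mul, inv_mul_cancel₀ hy, map_one] at this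
    | succ i ih =>
      obtain ⟨h1, h2, h3⟩ := ih
      obtain ⟨k1, k2, k3⟩ := (T.step i).isStable_and_isDifferenceSimple h2 h3 fun x hx hx0 => by
        obtain ⟨y, -, rfl⟩ : x ∈ (constField σF).toSubring.map (algebraMap F E) := hc ▸ hx
        have hy : y ≠ 0 := by
          rintro rfl
          exact hx0 (map_zero _)
        exact ⟨algebraMap F E y⁻¹, h1 ⟨_, rfl⟩, by rw [← map_mul, inv_mul_cancel₀ hy, map_one]⟩
      exact ⟨h1.trans k1, k2, k3⟩
  exact T.ring_last ▸ (key (Fin.last T.e)).2.2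

/-- The constants of the ring of sequences are the constant sequences. -/
theorem SeqRing.exists_const_of_shift_eq {K : Type*} [CommRing K] {f : SeqRing K}
    (hf : SeqRing.shift K f = f) : ∃ c : K, f = ((fun _ : ℕ => c : ℕ → K) : SeqRing K) := by
  induction f using Germ.inductionOn with
  | h f =>
    have hf' : ((fun n => f (n + 1) : ℕ → K) : SeqRing K) = (f : SeqRing K) := hf
    obtain ⟨N, hN⟩ := eventually_atTop.1 (Germ.coe_eq.1 hf')
    refine ⟨f N, Germ.coe_eq.2 (eventually_atTop.2 ⟨N, fun n hn => ?_⟩)⟩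
    induction n, hn using Nat.le_induction with
    | base => rfl
    | succ n hn ih => exact (hN n hn).trans ih

theorem mainTheorem2 {F E : Type*} [Field F] [CommRing E] [Algebra F E]
    (σF : F ≃+* F) (σE : E ≃+* E) (T : APSExtension σF σE) (hT : T.IsBasic)
    (τ : E →+* SeqRing (constField σF)) (hτ : IsKHomomorphism σF σE τ) :
    Function.Injective τ ↔
      constRing σE = (constField σF).toSubring.map (algebraMap F E) := by
  constructor
  · intro hinj
    ext x
    constructor
    · intro hx
      obtain ⟨c, hc⟩ := SeqRing.exists_const_of_shift_eq (f := τ x) (by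
        rw [← hτ.map_shift, show σE x = x from hx])
      refine ⟨c, c.2, hinj ?_⟩
      rw [hτ.map_const, hc]
    · rintro ⟨y, hy, rfl⟩
      change σE _ = _
      rw [T.isDifferenceExtension.commutes, show σF y = y from hy]
  · intro hc
    by_contra hinj
    rw [injective_iff_map_eq_zero] at hinj
    push Not at hinj
    -- The kernel is stable in both directions because the shift is injective; containing `1`
    -- contradicts `τ 1 = 1 ≠ 0`.
    have h1 : (1 : E) ∈ (RingHom.ker τ).toAddSubgroup := by
      refine T.isDifferenceSimple_top hc _ (fun _ _ => Subring.mem_top _)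
        (fun b _ x hx => (RingHom.ker τ).mul_mem_left b hx) (fun x => ?_) hinj
      change τ (σE x) = 0 ↔ τ x = 0
      rw [hτ.map_shift, map_eq_zero_iff _ (SeqRing.shift _).injective]
    have h2 : τ 1 = 0 := h1
    rw [map_one] at h2
    exact one_ne_zero h2
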